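/- Let $n\ge 1$, $N\ge n$, and let $M\subset\mathbb C^N$ be a compact, smoothly embedded real submanifold of dimension $2n-1$. Let $T^{1,0}_p(M)=T^{1,0}_p(\mathbb C^N)\cap(T_p(M)\otimes\mathbb C)$ and $T^{0,1}_p(M)=\overline{T^{1,0}_p(M)}$, and assume that $\dim_{\mathbb C}T^{1,0}_p(M)=n-1$ for all $p\in M$, so that $M$ is a CR-manifold of hypersurface type with the induced CR-structure. For a purely imaginary $1$-form $\gamma$ on $M$ annihilating $T^{1,0}(M)\oplus T^{0,1}(M)$, the Levi form is $\langle d\gamma,L\wedge\bar L'\rangle$, where $\langle\eta,Z\wedge W\rangle=\eta(Z,W)$ and $d\gamma(X,Y)=X\gamma(Y)-Y\gamma(X)-\gamma([X,Y])$. Assume that $M$ is weakly pseudoconvex: for some global nowhere vanishing smooth such $\gamma$ the Levi form is positive semi-definite at every point. Equip $T(\mathbb C^N)\otimes\mathbb C$ with the Hermitian inner product in which the vectors $\partial/\partial z_j,\ \partial/\partial\bar z_j$ are orthonormal. For a function $\lambda$ smooth near $M$, let $\partial_b\lambda$ (resp. $\bar\partial_b\lambda$) be the $1$-form on $M$ that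 equals $d\lambda$ on $T^{1,0}(M)$ (resp. $T^{0,1}(M)$) and vanishes on the orthogonal complement of that bundle in $T(M)\otimes\mathbb C$; let $\partial_b\bar\partial_b\lambda$ and $\bar\partial_b\partial_b\lambda$ be the $(1,1)$-parts, with respect to $T^{1,0}(M)\oplus T^{0,1}(M)$, of the exterior derivatives on $M$ of $\bar\partial_b\lambda$ and $\partial_b\lambda$. Let $U\subset M$ be open (for instance $U=M$), and let $L_n$ be a smooth field on $U$ of unit vectors in $T^{1,0}(\mathbb C^N)$, orthogonal to $T^{1,0}(M)$, such that $T=L_n-\bar L_n$ is tangent to $M$ (that is, $T\in T(M)\otimes\mathbb C$). Let $\nu=L_n+\bar L_n$ be the corresponding "real normal", and let $\gamma$ be the smooth purely imaginary $1$-form on $U$ that annihilates $T^{1,0}(M)\oplus T^{0,1}(M)$ and satisfies $\langle\gamma,T\rangle=-1$. **Proposition.** If $\lambda$ is a smooth complex-valued function on a neighborhood of $M$ in $\mathbb C^N$, then for every $p\in U$ and every $L\in T^{1,0}_p(M)$, at the point $p$, $$\Big\langle\tfrac12\big(\partial\bar\partial\lambda-\bar\partial\partial\lambda\big),L\wedge\bar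 L\Big\rangle-\Big\langle\tfrac12\big(\partial_b\bar\partial_b\lambda-\bar\partial_b\partial_b\lambda\big),L\wedge\bar L\Big\rangle=\tfrac12\,\nu\{\lambda\}\,\langle d\gamma,L\wedge\bar L\rangle .$$ -/

import Mathlib

open scoped ContDiff Manifold

noncomputable section

/-! ### The complexified tangent space of `ℂ^N` -/

/-- `ℂ^N` with its Euclidean norm; it also serves as the real tangent space of `ℂ^N` at each point. -/
abbrev CSpace (N : ℕ) : Type := EuclideanSpace ℂ (Fin N)

/-- The complexified tangent space `T(ℂ^N) ⊗ ℂ` at a point, written in the basis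
`∂/∂z_j` (index `Sum.inl j`), `∂/∂z̄_j` (index `Sum.inr j`), with the Hermitian inner product in
which this basis is orthonormal. -/
abbrev CTan (N : ℕ) : Type := EuclideanSpace ℂ (Fin N ⊕ Fin N)

variable {N : ℕ}

/-- The complexified tangent vector of a real tangent vector `v`:
`∑ v_j ∂/∂z_j + ∑ conj v_j ∂/∂z̄_j`. -/
def CTan.ofReal : CSpace N →L[ℝ] CTan N :=
  LinearMap.toContinuousLinearMap
    { toFun := fun v => WithLp.toLp 2 (Sum.elim (fun j => v j) (fun j => starRingEnd ℂ (v j)))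
      map_add' := by
        intro v w
        ext (j | j) <;> simp
      map_smul' := by
        intro c v
        ext (j | j) <;> simp }

/-- The real tangent vector `X` in the decomposition `Z = X + i Y`. -/
def CTan.re : CTan N →L[ℝ] CSpace N :=
  LinearMap.toContinuousLinearMap
    { toFun := fun Z => WithLp.toLp 2
        (fun j => (Z (Sum.inl j) + starRingEnd ℂ (Z (Sum.inr j))) / 2)
      map_add' := by
        intro v w
        ext j
        simp
        ring
      map_smul' := by
        intro c v
        ext j
        simp
        ring }

/-- The real tangent vector `Y` in the decomposition `Z = X + i Y`. -/
def CTan.im : CTan N →L[ℝ] CSpace N :=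
  LinearMap.toContinuousLinearMap
    { toFun := fun Z => WithLp.toLp 2
        (fun j => (Z (Sum.inl j) - starRingEnd ℂ (Z (Sum.inr j))) / (2 * Complex.I))
      map_add' := by
        intro v w
        ext j
        simp
        ring
      map_smul' := by
        intro c v
        ext j
        simp
        ring }

theorem CTan.re_add_im (Z : CTan N) :
    CTan.ofReal (CTan.re Z) + Complex.I • CTan.ofReal (CTan.im Z) = Z := by
  have hI : Complex.I ≠ 0 := Complex.I_ne_zero
  ext (j | j)
  · simp [CTan.ofReal, CTan.re, CTan.im]
    field_simp
    ring
  · simp [CTan.ofReal, CTan.re, CTan.im]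
    field_simp
    simp only [Complex.conj_ofNat]
    ring

/-- Complex conjugation `X + i Y ↦ X - i Y` of complexified tangent vectors; it exchanges
`∂/∂z_j` and `∂/∂z̄_j`. -/
def CTan.conj : CTan N →ₛₗ[starRingEnd ℂ] CTan N where
  toFun Z := WithLp.toLp 2 (Sum.elim (fun j => starRingEnd ℂ (Z (Sum.inr j)))
    (fun j => starRingEnd ℂ (Z (Sum.inl j))))
  map_add' := by
    intro v w
    ext (j | j) <;> simp
  map_smul' := by
    intro c v
    ext (j | j) <;> simp

/-- `T^{1,0}(ℂ^N)` at a point: the span of the `∂/∂z_j`. -/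
def CTan.T10 (N : ℕ) : Submodule ℂ (CTan N) where
  carrier := {Z | ∀ j, Z (Sum.inr j) = 0}
  zero_mem' := by
    intro j
    simp
  add_mem' := by
    intro v w hv hw j
    simp [hv j, hw j]
  smul_mem' := by
    intro c v hv j
    simp [hv j]

/-- `T^{0,1}(ℂ^N)` at a point, the conjugate of `T^{1,0}(ℂ^N)`. -/
def CTan.T01 (N : ℕ) : Submodule ℂ (CTan N) := (CTan.T10 N).map CTan.conj

/-! ### Pairing complex-valued forms with complexified tangent vectors -/

/-- The pairing `⟨α, X + i Y⟩ = α(X) + i α(Y)` of a complex-valued 1-form. -/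
def pair1 (α : CSpace N →L[ℝ] ℂ) : CTan N →L[ℝ] ℂ :=
  α.comp CTan.re + Complex.I • α.comp CTan.im

/-- The pairing `⟨η, Z ∧ W⟩` of a complex-valued 2-form: the complex bilinear extension of `η`. -/
def pair2 (η : CSpace N [⋀^Fin 2]→L[ℝ] ℂ) (Z W : CTan N) : ℂ :=
  η ![CTan.re Z, CTan.re W] - η ![CTan.im Z, CTan.im W]
    + Complex.I * (η ![CTan.re Z, CTan.im W] + η ![CTan.im Z, CTan.re W])

/-- The component of a complex-valued 1-form along a complex subspace `S` of complexified tangent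
vectors: the 1-form `α ∘ (orthogonal projection onto S)`. -/
def component1 (S : Submodule ℂ (CTan N)) (α : CSpace N →L[ℝ] ℂ) : CSpace N →L[ℝ] ℂ :=
  (pair1 α).comp ((S.starProjection.restrictScalars ℝ).comp CTan.ofReal)

/-- The `(1,1)`-component of a complex-valued 2-form with respect to orthogonal subspaces `S` and
`S'` of vectors of type `(1,0)` and `(0,1)`, as a bilinear form on complexified vectors. -/
def component11 (S S' : Submodule ℂ (CTan N)) (η : CSpace N [⋀^Fin 2]→L[ℝ] ℂ)
    (Z W : CTan N) : ℂ :=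
  pair2 η (S.starProjection Z) (S'.starProjection W)
    + pair2 η (S'.starProjection Z) (S.starProjection W)

/-- The exterior derivative of a complex-valued 1-form on a real normed space, normalised so that
`dα(X, Y) = (D_X α)(Y) - (D_Y α)(X)`. -/
def extDeriv1 {V : Type*} [NormedAddCommGroup V] [NormedSpace ℝ V] (α : V → V →L[ℝ] ℂ) (x : V) :
    V [⋀^Fin 2]→L[ℝ] ℂ :=
  extDeriv (fun y => ContinuousAlternatingMap.ofSubsingleton ℝ V ℂ (0 : Fin 1) (α y)) x

/-! ### The operators `∂` and `∂̄` on `ℂ^N` -/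

/-- `∂λ`, the `(1,0)`-part of `dλ`. -/
def del (lam : CSpace N → ℂ) (x : CSpace N) : CSpace N →L[ℝ] ℂ :=
  component1 (CTan.T10 N) (fderiv ℝ lam x)

/-- `∂̄λ`, the `(0,1)`-part of `dλ`. -/
def dbar (lam : CSpace N → ℂ) (x : CSpace N) : CSpace N →L[ℝ] ℂ :=
  component1 (CTan.T01 N) (fderiv ℝ lam x)

/-- `∂α` for a form `α` of type `(0,1)`: the `(1,1)`-part of `dα`. -/
def del01 (α : CSpace N → CSpace N →L[ℝ] ℂ) (x : CSpace N) (Z W : CTan N) : ℂ :=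
  component11 (CTan.T10 N) (CTan.T01 N) (extDeriv1 α x) Z W

/-- `∂̄β` for a form `β` of type `(1,0)`: the `(1,1)`-part of `dβ`. -/
def dbar10 (β : CSpace N → CSpace N →L[ℝ] ℂ) (x : CSpace N) (Z W : CTan N) : ℂ :=
  component11 (CTan.T10 N) (CTan.T01 N) (extDeriv1 β x) Z W

/-! ### Embedded manifolds, the induced CR structure and forms on them

A 1-form on a manifold `M` mapped to `ℂ^N` by `ι` is written as a function
`α : M → (CSpace N →L[ℝ] ℂ)`; only the values of `α p` on vectors tangent to `M` at `p` matter. -/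

variable (m : ℕ) {M : Type*} [TopologicalSpace M] [ChartedSpace (EuclideanSpace ℝ (Fin m)) M]

/-- The differential of `ι` at `p`, as a map from the model space. -/
def embDeriv (ι : M → CSpace N) (p : M) : EuclideanSpace ℝ (Fin m) →L[ℝ] CSpace N :=
  mfderiv (𝓡 m) 𝓘(ℝ, CSpace N) ι p

/-- The real tangent space `T_p(M)` as a subspace of `ℂ^N`. -/
def tangentSub (ι : M → CSpace N) (p : M) : Submodule ℝ (CSpace N) :=
  LinearMap.range (embDeriv m ι p).toLinearMap

/-- The complexified tangent space `T_p(M) ⊗ ℂ`. -/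
def complexTangent (ι : M → CSpace N) (p : M) : Submodule ℂ (CTan N) :=
  Submodule.span ℂ (CTan.ofReal '' (tangentSub m ι p : Set (CSpace N)))

/-- `T^{1,0}_p(M) = T^{1,0}(ℂ^N) ∩ (T_p(M) ⊗ ℂ)`. -/
def T10M (ι : M → CSpace N) (p : M) : Submodule ℂ (CTan N) :=
  CTan.T10 N ⊓ complexTangent m ι p

/-- `T^{0,1}_p(M)`, the conjugate of `T^{1,0}_p(M)`. -/
def T01M (ι : M → CSpace N) (p : M) : Submodule ℂ (CTan N) :=
  (T10M m ι p).map CTan.conj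

/-- The pull-back of a 1-form on `M` to the coordinates of the preferred chart at `p`. -/
def chartForm (ι : M → CSpace N) (α : M → CSpace N →L[ℝ] ℂ) (p : M)
    (u : EuclideanSpace ℝ (Fin m)) : EuclideanSpace ℝ (Fin m) →L[ℝ] ℂ :=
  (α ((extChartAt (𝓡 m) p).symm u)).comp (fderiv ℝ (ι ∘ (extChartAt (𝓡 m) p).symm) u)

/-- The exterior derivative on `M` of a 1-form on `M` at `p`, computed in the preferred chart at
`p`. Tangent vectors in `T_p(M)` are moved to the coordinates by the inverse of the (injective)
differential of `ι`; only the values on `T_p(M)` matter. -/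
def extDerivM (ι : M → CSpace N) (α : M → CSpace N →L[ℝ] ℂ) (p : M) :
    CSpace N [⋀^Fin 2]→L[ℝ] ℂ :=
  (extDeriv1 (chartForm m ι α p) (extChartAt (𝓡 m) p p)).compContinuousLinearMap
    (LinearMap.toContinuousLinearMap (embDeriv m ι p).toLinearMap.leftInverse)

/-- The CR structure induced on `M` has constant complex rank `n - 1`. -/
def IsCROfRank (ι : M → CSpace N) (n : ℕ) : Prop :=
  ∀ p, Module.finrank ℂ (T10M m ι p) = n - 1

/-- `γ` restricts on the open set `U` of `M` to a smooth, purely imaginary, nowhere vanishing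
1-form that annihilates `T^{1,0}(M) ⊕ T^{0,1}(M)`. -/
structure IsCharacteristicForm (ι : M → CSpace N) (U : Set M) (γ : M → CSpace N →L[ℝ] ℂ) :
    Prop where
  smooth : ContMDiffOn (𝓡 m) 𝓘(ℝ, CSpace N →L[ℝ] ℂ) ∞ γ U
  imaginary : ∀ p ∈ U, ∀ v ∈ tangentSub m ι p, (γ p v).re = 0
  annihilates : ∀ p ∈ U, ∀ Z ∈ T10M m ι p ⊔ T01M m ι p, pair1 (γ p) Z = 0
  nonvanishing : ∀ p ∈ U, ∃ v ∈ tangentSub m ι p, γ p v ≠ 0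

/-- The Levi form `⟨dγ_p, L ∧ conj L'⟩`. -/
def leviForm (ι : M → CSpace N) (γ : M → CSpace N →L[ℝ] ℂ) (p : M) (L L' : CTan N) : ℂ :=
  pair2 (extDerivM m ι γ p) L (CTan.conj L')

/-- `M` is weakly pseudoconvex: for some global characteristic form the Levi form is positive
semi-definite at every point. -/
def IsWeaklyPseudoconvex (ι : M → CSpace N) : Prop :=
  ∃ γ : M → CSpace N →L[ℝ] ℂ, IsCharacteristicForm m ι Set.univ γ ∧
    ∀ p, ∀ L ∈ T10M m ι p, 0 ≤ (leviForm m ι γ p L L).re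

/-- The last field `L_n` of a local orthonormal frame on the open set `U` of `M`: a smooth unit
field of type `(1,0)` in `ℂ^N`, orthogonal to `T^{1,0}(M)`, for which
`T = L_n - conj L_n` is tangent to `M`. -/
structure IsTransversalField (ι : M → CSpace N) (U : Set M) (Ln : M → CTan N) : Prop where
  smooth : ContMDiffOn (𝓡 m) 𝓘(ℝ, CTan N) ∞ Ln U
  type10 : ∀ p ∈ U, Ln p ∈ CTan.T10 N
  unit : ∀ p ∈ U, ‖Ln p‖ = 1
  orthogonal : ∀ p ∈ U, ∀ Z ∈ T10M m ι p, inner ℂ Z (Ln p) = 0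
  tangent : ∀ p ∈ U, Ln p - CTan.conj (Ln p) ∈ complexTangent m ι p

/-! ### The tangential operators `∂_b` and `∂̄_b` -/

/-- `∂_b λ`: the restriction of `dλ` to `T^{1,0}(M)`, extended by zero to the orthogonal
complement of `T^{1,0}(M)`. -/
def delb (ι : M → CSpace N) (lam : CSpace N → ℂ) (p : M) : CSpace N →L[ℝ] ℂ :=
  component1 (T10M m ι p) (fderiv ℝ lam (ι p))

/-- `∂̄_b λ`: the restriction of `dλ` to `T^{0,1}(M)`, extended by zero to the orthogonal
complement of `T^{0,1}(M)`. -/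
def dbarb (ι : M → CSpace N) (lam : CSpace N → ℂ) (p : M) : CSpace N →L[ℝ] ℂ :=
  component1 (T01M m ι p) (fderiv ℝ lam (ι p))

/-- `∂_b α` for a form `α` of type `(0,1)` on `M`: the `(1,1)`-part of the exterior derivative of
`α` on `M`. -/
def delb01 (ι : M → CSpace N) (α : M → CSpace N →L[ℝ] ℂ) (p : M) (Z W : CTan N) : ℂ :=
  component11 (T10M m ι p) (T01M m ι p) (extDerivM m ι α p) Z W

/-- `∂̄_b β` for a form `β` of type `(1,0)` on `M`: the `(1,1)`-part of the exterior derivative of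
`β` on `M`. -/
def dbarb10 (ι : M → CSpace N) (β : M → CSpace N →L[ℝ] ℂ) (p : M) (Z W : CTan N) : ℂ :=
  component11 (T10M m ι p) (T01M m ι p) (extDerivM m ι β p) Z W

end

/-!
A vector `Z` tangent to `M` splits as `Z = Z¹⁰ + Z⁰¹ - γ(Z) (L_n - L̄_n)` with `Z¹⁰`, `Z⁰¹` its
components in `T^{1,0}(M)`, `T^{0,1}(M)`. Hence the types of `Z` in `ℂ^N` differ from its types in
`M` only by multiples of `L_n` and `L̄_n`, and applying `dλ` gives, as forms on `M`,
`∂_bλ = ∂λ + (L_n λ) γ` and `∂̄_bλ = ∂̄λ - (L̄_n λ) γ`. Exterior differentiation commutes with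
restriction to `M`, and `d(gγ) = dg ∧ γ + g dγ` agrees with `g dγ` on vectors annihilated by `γ`.
The terms `(L_n λ) dγ` and `-(L̄_n λ) dγ` therefore account for the whole difference.
-/

open scoped Topology

section LinearAlgebra

theorem finrank_map_conjLinear {E F : Type*} [AddCommGroup E] [Module ℂ E] [AddCommGroup F]
    [Module ℂ F] {f : E →ₛₗ[starRingEnd ℂ] F} (hf : Function.Injective f) (S : Submodule ℂ E) :
    Module.finrank ℂ (S.map f) = Module.finrank ℂ S := by
  let e := Submodule.equivMapOfInjective f hf S
  have h := lift_rank_eq_of_equiv_equiv (starRingEnd ℂ) e.toAddEquiv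
    (starRingAut (R := ℂ)).bijective e.map_smulₛₗ
  simpa [Module.finrank] using (congrArg Cardinal.toNat h).symm

theorem finrank_span_image_le {K A E F : Type*} [Field K] [Field A] [Algebra K A]
    [AddCommGroup E] [Module K E] [AddCommGroup F] [Module K F] [Module A F] [IsScalarTower K A F]
    (f : E →ₗ[K] F) (S : Submodule K E) [FiniteDimensional K S] :
    Module.finrank A (Submodule.span A (f '' (S : Set E))) ≤ Module.finrank K S := by
  let b := Module.finBasis K S
  have hS : S.map f = Submodule.span K (Set.range fun i => f (b i)) := by
    conv_lhs => rw [← S.range_subtype, ← Submodule.map_top S.subtype, ← b.span_eq]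
    rw [Submodule.map_span, Submodule.map_span, ← Set.range_comp, ← Set.range_comp]
    rfl
  rw [← Submodule.map_coe, hS, Submodule.span_span_of_tower]
  exact (finrank_range_le_card _).trans_eq (Fintype.card_fin _)

theorem finrank_sup_of_disjoint {K E : Type*} [DivisionRing K] [AddCommGroup E] [Module K E]
    {S S' : Submodule K E} [FiniteDimensional K S] [FiniteDimensional K S'] (h : Disjoint S S') :
    Module.finrank K (S ⊔ S' : Submodule K E) = Module.finrank K S + Module.finrank K S' := by
  rw [← Submodule.finrank_sup_add_finrank_inf_eq, h.eq_bot, finrank_bot, add_zero]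

theorem starProjection_eq_zero_of_isOrtho {𝕜 E : Type*} [RCLike 𝕜] [NormedAddCommGroup E]
    [InnerProductSpace 𝕜 E] {S S' : Submodule 𝕜 E} [S.HasOrthogonalProjection] (h : S ⟂ S') {Z : E}
    (hZ : Z ∈ S') : S.starProjection Z = 0 :=
  (Submodule.starProjection_apply_eq_zero_iff S).2 (h.symm hZ)

end LinearAlgebra

namespace CTan

variable {N : ℕ}

theorem ofReal_inl (v : CSpace N) (j : Fin N) : ofReal v (Sum.inl j) = v j := rfl

theorem ofReal_inr (v : CSpace N) (j : Fin N) :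
    ofReal v (Sum.inr j) = starRingEnd ℂ (v j) := rfl

theorem conj_inl (Z : CTan N) (j : Fin N) :
    conj Z (Sum.inl j) = starRingEnd ℂ (Z (Sum.inr j)) := rfl

theorem conj_inr (Z : CTan N) (j : Fin N) :
    conj Z (Sum.inr j) = starRingEnd ℂ (Z (Sum.inl j)) := rfl

theorem re_apply (Z : CTan N) (j : Fin N) :
    re Z j = (Z (Sum.inl j) + starRingEnd ℂ (Z (Sum.inr j))) / 2 := rfl

theorem im_apply (Z : CTan N) (j : Fin N) :
    im Z j = (Z (Sum.inl j) - starRingEnd ℂ (Z (Sum.inr j))) / (2 * Complex.I) := rfl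

@[simp]
theorem conj_conj (Z : CTan N) : conj (conj Z) = Z := by
  ext (j | j) <;> simp [conj_inl, conj_inr]

@[simp]
theorem conj_ofReal (v : CSpace N) : conj (ofReal v) = ofReal v := by
  ext (j | j) <;> simp [conj_inl, conj_inr, ofReal_inl, ofReal_inr]

theorem conj_injective : Function.Injective (conj (N := N)) :=
  Function.LeftInverse.injective conj_conj

@[simp]
theorem re_ofReal (v : CSpace N) : re (ofReal v) = v := by
  ext j
  simp [re_apply, ofReal_inl, ofReal_inr]

@[simp]
theorem im_ofReal (v : CSpace N) : im (ofReal v) = 0 := by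
  ext j
  simp [im_apply, ofReal_inl, ofReal_inr]

@[simp]
theorem re_conj (Z : CTan N) : re (conj Z) = re Z := by
  ext j
  simp [re_apply, conj_inl, conj_inr, add_comm]

@[simp]
theorem im_conj (Z : CTan N) : im (conj Z) = -im Z := by
  ext j
  simp only [im_apply, conj_inl, conj_inr, Complex.conj_conj, PiLp.neg_apply]
  ring

theorem re_I_smul (Z : CTan N) : re (Complex.I • Z) = -im Z := by
  ext j
  simp only [re_apply, im_apply, PiLp.smul_apply, PiLp.neg_apply, smul_eq_mul, map_mul,
    Complex.conj_I]
  field_simp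
  linear_combination (Z (Sum.inl j) - starRingEnd ℂ (Z (Sum.inr j))) * Complex.I_sq

theorem im_I_smul (Z : CTan N) : im (Complex.I • Z) = re Z := by
  ext j
  simp only [re_apply, im_apply, PiLp.smul_apply, smul_eq_mul, map_mul, Complex.conj_I]
  field_simp
  ring

theorem smul_eq_re_smul_add (c : ℂ) (Z : CTan N) :
    c • Z = c.re • Z + c.im • Complex.I • Z := by
  nth_rw 1 [← Complex.re_add_im c]
  rw [add_smul, mul_smul]
  simp

theorem re_smul (c : ℂ) (Z : CTan N) : re (c • Z) = c.re • re Z - c.im • im Z := by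
  rw [smul_eq_re_smul_add, map_add, map_smul, map_smul, re_I_smul, smul_neg, sub_eq_add_neg]

theorem im_smul (c : ℂ) (Z : CTan N) : im (c • Z) = c.re • im Z + c.im • re Z := by
  rw [smul_eq_re_smul_add, map_add, map_smul, map_smul, im_I_smul]

theorem conj_eq_ofReal_re_sub (Z : CTan N) :
    conj Z = ofReal (re Z) - Complex.I • ofReal (im Z) := by
  nth_rw 1 [← re_add_im Z]
  simp [LinearMap.map_smulₛₗ, sub_eq_add_neg]

theorem ofReal_re_eq (Z : CTan N) : ofReal (re Z) = (1 / 2 : ℂ) • (Z + conj Z) := by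
  nth_rw 2 [← re_add_im Z]
  rw [conj_eq_ofReal_re_sub]
  module

theorem mem_span_ofReal_image {S : Submodule ℝ (CSpace N)} {Z : CTan N} :
    Z ∈ Submodule.span ℂ (ofReal '' (S : Set (CSpace N))) ↔ re Z ∈ S ∧ im Z ∈ S := by
  refine ⟨fun hZ => ?_, fun ⟨hre, him⟩ => ?_⟩
  · induction hZ using Submodule.span_induction with
    | mem _ hx =>
      obtain ⟨v, hv, rfl⟩ := hx
      simpa using hv
    | zero => simp
    | add X Y _ _ hX hY => simpa only [map_add] using ⟨add_mem hX.1 hY.1, add_mem hX.2 hY.2⟩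
    | smul c X _ hX =>
      rw [re_smul, im_smul]
      exact ⟨sub_mem (S.smul_mem _ hX.1) (S.smul_mem _ hX.2),
        add_mem (S.smul_mem _ hX.2) (S.smul_mem _ hX.1)⟩
  · rw [← re_add_im Z]
    exact add_mem (Submodule.subset_span ⟨_, hre, rfl⟩)
      (Submodule.smul_mem _ _ (Submodule.subset_span ⟨_, him, rfl⟩))

theorem inner_conj_conj (Z W : CTan N) :
    inner ℂ (conj Z) (conj W) = starRingEnd ℂ (inner ℂ Z W) := by
  simp only [PiLp.inner_apply, Fintype.sum_sum_type, conj_inl, conj_inr, map_add, map_sum,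
    RCLike.inner_apply, map_mul]
  rw [add_comm]

theorem conj_mem_orthogonal_map {S : Submodule ℂ (CTan N)} {Z : CTan N} (hZ : Z ∈ Sᗮ) :
    conj Z ∈ (S.map conj)ᗮ := by
  rintro _ ⟨W, hW, rfl⟩
  rw [inner_conj_conj, hZ W hW, map_zero]

theorem isOrtho_T10_T01 : T10 N ⟂ T01 N := by
  rw [Submodule.isOrtho_iff_inner_eq]
  rintro Z hZ _ ⟨W, hW, rfl⟩
  simp [PiLp.inner_apply, conj_inl, conj_inr, show ∀ j, Z (Sum.inr j) = 0 from hZ,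
    show ∀ j, W (Sum.inr j) = 0 from hW]

theorem conj_mem_T01 {Z : CTan N} (hZ : Z ∈ T10 N) : conj Z ∈ T01 N :=
  Submodule.mem_map_of_mem hZ

theorem starProjection_T10_sub_conj {Z : CTan N} (hZ : Z ∈ T10 N) :
    (T10 N).starProjection (Z - conj Z) = Z := by
  rw [map_sub, Submodule.starProjection_eq_self_iff.2 hZ,
    starProjection_eq_zero_of_isOrtho isOrtho_T10_T01 (conj_mem_T01 hZ), sub_zero]

theorem starProjection_T01_sub_conj {Z : CTan N} (hZ : Z ∈ T10 N) :
    (T01 N).starProjection (Z - conj Z) = -conj Z := by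
  rw [map_sub, starProjection_eq_zero_of_isOrtho isOrtho_T10_T01.symm hZ,
    Submodule.starProjection_eq_self_iff.2 (conj_mem_T01 hZ), zero_sub]

theorem sub_conj_ne_zero {Z : CTan N} (hZ : Z ∈ T10 N) (h0 : Z ≠ 0) : Z - conj Z ≠ 0 := fun h =>
  h0 <| by rw [← starProjection_T10_sub_conj hZ, h, map_zero]

theorem differentiable_conj : Differentiable ℝ (conj : CTan N → CTan N) := by
  rw [funext (conj_eq_ofReal_re_sub (N := N))]
  fun_prop

end CTan

section Pairing

variable {N : ℕ}

theorem pair1_apply (α : CSpace N →L[ℝ] ℂ) (Z : CTan N) :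
    pair1 α Z = α (CTan.re Z) + Complex.I * α (CTan.im Z) := rfl

theorem pair1_smul (α : CSpace N →L[ℝ] ℂ) (c : ℂ) (Z : CTan N) :
    pair1 α (c • Z) = c * pair1 α Z := by
  simp only [pair1_apply, CTan.re_smul, CTan.im_smul, map_add, map_sub, map_smul,
    Complex.real_smul]
  nth_rw 5 [← Complex.re_add_im c]
  linear_combination (-(c.im : ℂ) * α (CTan.im Z)) * Complex.I_sq

@[simp]
theorem pair1_ofReal (α : CSpace N →L[ℝ] ℂ) (v : CSpace N) :
    pair1 α (CTan.ofReal v) = α v := by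
  simp [pair1_apply]

theorem differentiable_pair1 :
    Differentiable ℝ fun x : (CSpace N →L[ℝ] ℂ) × CTan N => pair1 x.1 x.2 := by
  simp only [pair1_apply]
  fun_prop

theorem component1_apply (S : Submodule ℂ (CTan N)) (α : CSpace N →L[ℝ] ℂ) (v : CSpace N) :
    component1 S α v = pair1 α (S.starProjection (CTan.ofReal v)) := rfl

theorem differentiable_component1 (S : Submodule ℂ (CTan N)) :
    Differentiable ℝ (component1 S) := by
  unfold component1 pair1
  fun_prop

theorem pair2_zero_left (η : CSpace N [⋀^Fin 2]→L[ℝ] ℂ) (Z : CTan N) : pair2 η 0 Z = 0 := by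
  have h (y : CSpace N) : η ![0, y] = 0 := η.map_coord_zero 0 rfl
  simp [pair2, h]

theorem pair2_eq_add_mul {S : Submodule ℝ (CSpace N)} {η η₁ η₂ : CSpace N [⋀^Fin 2]→L[ℝ] ℂ}
    {c : ℂ} (h : ∀ x ∈ S, ∀ y ∈ S, η ![x, y] = η₁ ![x, y] + c * η₂ ![x, y]) {Z W : CTan N}
    (hZ : Z ∈ Submodule.span ℂ (CTan.ofReal '' (S : Set (CSpace N))))
    (hW : W ∈ Submodule.span ℂ (CTan.ofReal '' (S : Set (CSpace N)))) :
    pair2 η Z W = pair2 η₁ Z W + c * pair2 η₂ Z W := by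
  obtain ⟨hZre, hZim⟩ := CTan.mem_span_ofReal_image.1 hZ
  obtain ⟨hWre, hWim⟩ := CTan.mem_span_ofReal_image.1 hW
  rw [pair2, h _ hZre _ hWre, h _ hZim _ hWim, h _ hZre _ hWim, h _ hZim _ hWre, pair2, pair2]
  ring

theorem component11_apply_of_mem {S S' : Submodule ℂ (CTan N)} (h : S ⟂ S')
    (η : CSpace N [⋀^Fin 2]→L[ℝ] ℂ) {Z W : CTan N} (hZ : Z ∈ S) (hW : W ∈ S') :
    component11 S S' η Z W = pair2 η Z W := by
  rw [component11, Submodule.starProjection_eq_self_iff.2 hZ,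
    Submodule.starProjection_eq_self_iff.2 hW, starProjection_eq_zero_of_isOrtho h.symm hZ,
    pair2_zero_left, add_zero]

end Pairing

section CRStructure

variable {N m : ℕ} {M : Type*} [TopologicalSpace M] [ChartedSpace (EuclideanSpace ℝ (Fin m)) M]
  {ι : M → CSpace N} {p : M}

theorem conj_mem_complexTangent {Z : CTan N} (hZ : Z ∈ complexTangent m ι p) :
    CTan.conj Z ∈ complexTangent m ι p := by
  obtain ⟨hre, him⟩ := CTan.mem_span_ofReal_image.1 hZ
  exact CTan.mem_span_ofReal_image.2 ⟨by simpa using hre, by simpa using him⟩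

theorem conj_mem_T01M {Z : CTan N} (hZ : Z ∈ T10M m ι p) : CTan.conj Z ∈ T01M m ι p :=
  Submodule.mem_map_of_mem hZ

theorem T10M_le_T10 : T10M m ι p ≤ CTan.T10 N :=
  inf_le_left

theorem T01M_le_T01 : T01M m ι p ≤ CTan.T01 N :=
  Submodule.map_mono T10M_le_T10

theorem T10M_sup_T01M_le_complexTangent : T10M m ι p ⊔ T01M m ι p ≤ complexTangent m ι p := by
  refine sup_le inf_le_right ?_
  rintro _ ⟨Z, hZ, rfl⟩
  exact conj_mem_complexTangent hZ.2

theorem isOrtho_T10M_T01M : T10M m ι p ⟂ T01M m ι p :=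
  CTan.isOrtho_T10_T01.mono T10M_le_T10 T01M_le_T01

theorem conj_mem_T10M_sup_T01M {Z : CTan N} (hZ : Z ∈ T10M m ι p ⊔ T01M m ι p) :
    CTan.conj Z ∈ T10M m ι p ⊔ T01M m ι p := by
  obtain ⟨X, hX, _, ⟨Y, hY, rfl⟩, rfl⟩ := Submodule.mem_sup.1 hZ
  rw [map_add, CTan.conj_conj, add_comm]
  exact Submodule.add_mem_sup hY (conj_mem_T01M hX)

variable (m ι p) in
/-- The maximal complex subspace `T_p(M) ∩ i T_p(M)` of the real tangent space, encoded as the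
space of real vectors in `T^{1,0}_p(M) ⊕ T^{0,1}_p(M)`. -/
noncomputable def holTangent : Submodule ℝ (CSpace N) :=
  ((T10M m ι p ⊔ T01M m ι p).restrictScalars ℝ).comap
    (CTan.ofReal : CSpace N →L[ℝ] CTan N).toLinearMap

theorem holTangent_le_tangentSub : holTangent m ι p ≤ tangentSub m ι p := fun v hv => by
  simpa using (CTan.mem_span_ofReal_image.1 (T10M_sup_T01M_le_complexTangent hv)).1

theorem T10M_sup_T01M_le_span_holTangent : T10M m ι p ⊔ T01M m ι p ≤
    Submodule.span ℂ (CTan.ofReal '' (holTangent m ι p : Set (CSpace N))) := by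
  have re_mem : ∀ Z ∈ T10M m ι p ⊔ T01M m ι p, CTan.re Z ∈ holTangent m ι p := fun Z hZ => by
    change CTan.ofReal (CTan.re Z) ∈ T10M m ι p ⊔ T01M m ι p
    rw [CTan.ofReal_re_eq]
    exact Submodule.smul_mem _ _ (add_mem hZ (conj_mem_T10M_sup_T01M hZ))
  intro Z hZ
  have im_mem := re_mem _ (Submodule.smul_mem _ Complex.I hZ)
  rw [CTan.re_I_smul, neg_mem_iff] at im_mem
  exact CTan.mem_span_ofReal_image.2 ⟨re_mem Z hZ, im_mem⟩

variable {U : Set M} {Ln : M → CTan N} {γ : M → CSpace N →L[ℝ] ℂ}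

theorem IsCharacteristicForm.apply_eq_zero (hγ : IsCharacteristicForm m ι U γ) (hp : p ∈ U)
    {v : CSpace N} (hv : v ∈ holTangent m ι p) : γ p v = 0 := by
  rw [← pair1_ofReal]
  exact hγ.annihilates p hp _ hv

theorem finrank_tangentSub_le : Module.finrank ℝ (tangentSub m ι p) ≤ m :=
  (LinearMap.finrank_range_le (embDeriv m ι p).toLinearMap).trans_eq finrank_euclideanSpace_fin

theorem finrank_complexTangent_le :
    Module.finrank ℂ (complexTangent m ι p) ≤ Module.finrank ℝ (tangentSub m ι p) :=
  finrank_span_image_le (CTan.ofReal : CSpace N →L[ℝ] CTan N).toLinearMap (tangentSub m ι p)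

namespace IsTransversalField

theorem sub_conj_ne_zero (h : IsTransversalField m ι U Ln) (hp : p ∈ U) :
    Ln p - CTan.conj (Ln p) ≠ 0 :=
  CTan.sub_conj_ne_zero (h.type10 p hp) (norm_ne_zero_iff.1 (by simp [h.unit p hp]))

theorem sub_conj_mem_orthogonal (h : IsTransversalField m ι U Ln) (hp : p ∈ U) :
    Ln p - CTan.conj (Ln p) ∈ (T10M m ι p ⊔ T01M m ι p)ᗮ := by
  have hLn : Ln p ∈ (T10M m ι p)ᗮ := h.orthogonal p hp
  have hLn' : Ln p ∈ (T01M m ι p)ᗮ :=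
    CTan.isOrtho_T10_T01.mono_right T01M_le_T01 (h.type10 p hp)
  have hconj : CTan.conj (Ln p) ∈ (T10M m ι p)ᗮ :=
    CTan.isOrtho_T10_T01.symm.mono_right T10M_le_T10 (CTan.conj_mem_T01 (h.type10 p hp))
  have hconj' : CTan.conj (Ln p) ∈ (T01M m ι p)ᗮ := CTan.conj_mem_orthogonal_map hLn
  rw [← Submodule.inf_orthogonal]
  exact ⟨sub_mem hLn hconj, sub_mem hLn' hconj'⟩

theorem finrank_sup (h : IsTransversalField m ι U Ln) (hp : p ∈ U) :
    Module.finrank ℂ ((T10M m ι p ⊔ T01M m ι p ⊔ ℂ ∙ (Ln p - CTan.conj (Ln p)) :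
      Submodule ℂ (CTan N))) = 2 * Module.finrank ℂ (T10M m ι p) + 1 := by
  have hortho : T10M m ι p ⊔ T01M m ι p ⟂ ℂ ∙ (Ln p - CTan.conj (Ln p)) :=
    Submodule.IsOrtho.symm <|
      (Submodule.span_singleton_le_iff_mem _ _).2 (h.sub_conj_mem_orthogonal hp)
  have hT01M : Module.finrank ℂ (T01M m ι p) = Module.finrank ℂ (T10M m ι p) :=
    finrank_map_conjLinear CTan.conj_injective _
  rw [finrank_sup_of_disjoint hortho.disjoint, finrank_sup_of_disjoint isOrtho_T10M_T01M.disjoint,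
    hT01M, finrank_span_singleton (h.sub_conj_ne_zero hp), two_mul]

theorem sup_le_complexTangent (h : IsTransversalField m ι U Ln) (hp : p ∈ U) :
    T10M m ι p ⊔ T01M m ι p ⊔ ℂ ∙ (Ln p - CTan.conj (Ln p)) ≤ complexTangent m ι p :=
  sup_le T10M_sup_T01M_le_complexTangent
    ((Submodule.span_singleton_le_iff_mem _ _).2 (h.tangent p hp))

theorem le_finrank_complexTangent (h : IsTransversalField m ι U Ln) (hp : p ∈ U)
    (hm : m = 2 * Module.finrank ℂ (T10M m ι p) + 1) :
    m ≤ Module.finrank ℂ (complexTangent m ι p) := by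
  have := Submodule.finrank_mono (h.sup_le_complexTangent hp)
  rwa [h.finrank_sup hp, ← hm] at this

theorem sup_eq_complexTangent (h : IsTransversalField m ι U Ln) (hp : p ∈ U)
    (hm : m = 2 * Module.finrank ℂ (T10M m ι p) + 1) :
    T10M m ι p ⊔ T01M m ι p ⊔ ℂ ∙ (Ln p - CTan.conj (Ln p)) = complexTangent m ι p := by
  refine Submodule.eq_of_le_of_finrank_le (h.sup_le_complexTangent hp) ?_
  rw [h.finrank_sup hp, ← hm]
  exact finrank_complexTangent_le.trans finrank_tangentSub_le

theorem injective_embDeriv (h : IsTransversalField m ι U Ln) (hp : p ∈ U)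
    (hm : m = 2 * Module.finrank ℂ (T10M m ι p) + 1) :
    Function.Injective (embDeriv m ι p) := by
  have hrange : m ≤ Module.finrank ℝ (embDeriv m ι p).range :=
    (h.le_finrank_complexTangent hp hm).trans finrank_complexTangent_le
  have hsum := (embDeriv m ι p).toLinearMap.finrank_range_add_finrank_ker
  rw [finrank_euclideanSpace_fin] at hsum
  refine LinearMap.ker_eq_bot.1 (Submodule.finrank_eq_zero.1 (?_ : _ = 0))
  change m ≤ Module.finrank ℝ (embDeriv m ι p).toLinearMap.range at hrange
  omega

theorem eq_starProjection_add_sub (h : IsTransversalField m ι U Ln) (hp : p ∈ U)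
    (hm : m = 2 * Module.finrank ℂ (T10M m ι p) + 1) (hγ : IsCharacteristicForm m ι U γ)
    (hγT : pair1 (γ p) (Ln p - CTan.conj (Ln p)) = -1) {Z : CTan N}
    (hZ : Z ∈ complexTangent m ι p) :
    Z = (T10M m ι p).starProjection Z + (T01M m ι p).starProjection Z
      - pair1 (γ p) Z • (Ln p - CTan.conj (Ln p)) := by
  have hT := h.sub_conj_mem_orthogonal hp
  rw [← Submodule.inf_orthogonal] at hT
  rw [← h.sup_eq_complexTangent hp hm] at hZ
  obtain ⟨V, hV, W, hW, rfl⟩ := Submodule.mem_sup.1 hZ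
  obtain ⟨X, hX, Y, hY, rfl⟩ := Submodule.mem_sup.1 hV
  obtain ⟨c, rfl⟩ := Submodule.mem_span_singleton.1 hW
  have hT10M : (T10M m ι p).starProjection (X + Y + c • (Ln p - CTan.conj (Ln p))) = X := by
    rw [map_add, map_add, map_smul, Submodule.starProjection_eq_self_iff.2 hX,
      starProjection_eq_zero_of_isOrtho isOrtho_T10M_T01M hY,
      (Submodule.starProjection_apply_eq_zero_iff _).2 hT.1, smul_zero, add_zero, add_zero]
  have hT01M : (T01M m ι p).starProjection (X + Y + c • (Ln p - CTan.conj (Ln p))) = Y := by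
    rw [map_add, map_add, map_smul, Submodule.starProjection_eq_self_iff.2 hY,
      starProjection_eq_zero_of_isOrtho isOrtho_T10M_T01M.symm hX,
      (Submodule.starProjection_apply_eq_zero_iff _).2 hT.2, smul_zero, zero_add, add_zero]
  have hpair : pair1 (γ p) (X + Y + c • (Ln p - CTan.conj (Ln p))) = -c := by
    rw [map_add, hγ.annihilates p hp _ hV, pair1_smul, hγT, zero_add, mul_neg_one]
  rw [hT10M, hT01M, hpair, neg_smul, sub_neg_eq_add]

theorem starProjection_T10_eq (h : IsTransversalField m ι U Ln) (hp : p ∈ U)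
    (hm : m = 2 * Module.finrank ℂ (T10M m ι p) + 1) (hγ : IsCharacteristicForm m ι U γ)
    (hγT : pair1 (γ p) (Ln p - CTan.conj (Ln p)) = -1) {Z : CTan N}
    (hZ : Z ∈ complexTangent m ι p) :
    (CTan.T10 N).starProjection Z = (T10M m ι p).starProjection Z - pair1 (γ p) Z • Ln p := by
  have hX := T10M_le_T10 (Submodule.starProjection_apply_mem (T10M m ι p) Z)
  have hY := T01M_le_T01 (Submodule.starProjection_apply_mem (T01M m ι p) Z)
  refine (congrArg _ (h.eq_starProjection_add_sub hp hm hγ hγT hZ)).trans ?_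
  rw [map_sub, map_add, map_smul, Submodule.starProjection_eq_self_iff.2 hX,
    starProjection_eq_zero_of_isOrtho CTan.isOrtho_T10_T01 hY,
    CTan.starProjection_T10_sub_conj (h.type10 p hp), add_zero]

theorem starProjection_T01_eq (h : IsTransversalField m ι U Ln) (hp : p ∈ U)
    (hm : m = 2 * Module.finrank ℂ (T10M m ι p) + 1) (hγ : IsCharacteristicForm m ι U γ)
    (hγT : pair1 (γ p) (Ln p - CTan.conj (Ln p)) = -1) {Z : CTan N}
    (hZ : Z ∈ complexTangent m ι p) :
    (CTan.T01 N).starProjection Z =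
      (T01M m ι p).starProjection Z + pair1 (γ p) Z • CTan.conj (Ln p) := by
  have hX := T10M_le_T10 (Submodule.starProjection_apply_mem (T10M m ι p) Z)
  have hY := T01M_le_T01 (Submodule.starProjection_apply_mem (T01M m ι p) Z)
  refine (congrArg _ (h.eq_starProjection_add_sub hp hm hγ hγT hZ)).trans ?_
  rw [map_sub, map_add, map_smul, Submodule.starProjection_eq_self_iff.2 hY,
    starProjection_eq_zero_of_isOrtho CTan.isOrtho_T10_T01.symm hX,
    CTan.starProjection_T01_sub_conj (h.type10 p hp), zero_add, smul_neg, sub_neg_eq_add]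

theorem delb_eq (h : IsTransversalField m ι U Ln) (hp : p ∈ U)
    (hm : m = 2 * Module.finrank ℂ (T10M m ι p) + 1) (hγ : IsCharacteristicForm m ι U γ)
    (hγT : pair1 (γ p) (Ln p - CTan.conj (Ln p)) = -1) (lam : CSpace N → ℂ) {v : CSpace N}
    (hv : v ∈ tangentSub m ι p) :
    delb m ι lam p v = del lam (ι p) v + pair1 (fderiv ℝ lam (ι p)) (Ln p) * γ p v := by
  have hproj := h.starProjection_T10_eq hp hm hγ hγT (Submodule.subset_span ⟨v, hv, rfl⟩)
  rw [delb, del, component1_apply, component1_apply, hproj, map_sub, pair1_smul, pair1_ofReal]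
  ring

theorem dbarb_eq (h : IsTransversalField m ι U Ln) (hp : p ∈ U)
    (hm : m = 2 * Module.finrank ℂ (T10M m ι p) + 1) (hγ : IsCharacteristicForm m ι U γ)
    (hγT : pair1 (γ p) (Ln p - CTan.conj (Ln p)) = -1) (lam : CSpace N → ℂ) {v : CSpace N}
    (hv : v ∈ tangentSub m ι p) :
    dbarb m ι lam p v =
      dbar lam (ι p) v + -pair1 (fderiv ℝ lam (ι p)) (CTan.conj (Ln p)) * γ p v := by
  have hproj := h.starProjection_T01_eq hp hm hγ hγT (Submodule.subset_span ⟨v, hv, rfl⟩)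
  rw [dbarb, dbar, component1_apply, component1_apply, hproj, map_add, pair1_smul, pair1_ofReal]
  ring

end IsTransversalField

end CRStructure

section ExteriorDerivative

variable {V V' : Type*} [NormedAddCommGroup V] [NormedSpace ℝ V] [NormedAddCommGroup V']
  [NormedSpace ℝ V'] {α α' : V → V →L[ℝ] ℂ} {x : V}

theorem differentiableAt_ofSubsingleton (hα : DifferentiableAt ℝ α x) :
    DifferentiableAt ℝ
      (fun y => ContinuousAlternatingMap.ofSubsingleton ℝ V ℂ (0 : Fin 1) (α y)) x :=
  (ContinuousAlternatingMap.ofSubsingletonLIE (𝕜 := ℝ) (E := V) (F := ℂ)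
    (0 : Fin 1)).differentiableAt.comp x hα

theorem extDeriv1_congr (h : α =ᶠ[𝓝 x] α') : extDeriv1 α x = extDeriv1 α' x :=
  (h.fun_comp _).extDeriv_eq

theorem extDeriv1_apply (hα : DifferentiableAt ℝ α x) (v w : V) :
    extDeriv1 α x ![v, w] = fderiv ℝ α x v w - fderiv ℝ α x w v := by
  have h (a b : V) : fderiv ℝ (fun y => α y b) x a = fderiv ℝ α x a b := by
    simp [fderiv_clm_apply hα (differentiableAt_const b)]
  rw [extDeriv1, extDeriv_apply (differentiableAt_ofSubsingleton hα), Fin.sum_univ_two, ← h, ← h,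
    sub_eq_add_neg]
  simp only [Fin.val_zero, Fin.val_one, pow_zero, pow_one, one_smul, neg_smul]
  rfl

theorem extDeriv1_add (hα : DifferentiableAt ℝ α x) (hα' : DifferentiableAt ℝ α' x) :
    extDeriv1 (fun y => α y + α' y) x = extDeriv1 α x + extDeriv1 α' x :=
  extDeriv_add (differentiableAt_ofSubsingleton hα) (differentiableAt_ofSubsingleton hα')

theorem extDeriv1_smul_apply {g : V → ℂ} (hg : DifferentiableAt ℝ g x)
    (hα : DifferentiableAt ℝ α x) (v w : V) :
    extDeriv1 (fun y => g y • α y) x ![v, w] =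
      fderiv ℝ g x v * α x w - fderiv ℝ g x w * α x v + g x * extDeriv1 α x ![v, w] := by
  rw [extDeriv1_apply (hg.fun_smul hα), extDeriv1_apply hα, fderiv_fun_smul hg hα]
  simp only [add_apply, smul_apply, ContinuousLinearMap.smulRight_apply, smul_eq_mul]
  ring

theorem extDeriv1_comp_fderiv {β : V' → V' →L[ℝ] ℂ} {f : V → V'}
    (hβ : DifferentiableAt ℝ β (f x)) (hf : ContDiffAt ℝ 2 f x) :
    extDeriv1 (fun y => (β (f y)).comp (fderiv ℝ f y)) x =
      (extDeriv1 β (f x)).compContinuousLinearMap (fderiv ℝ f x) :=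
  extDeriv_pullback (differentiableAt_ofSubsingleton hβ) hf
    minSmoothness_of_isRCLikeNormedField.le

end ExteriorDerivative

section Chart

variable {E H F M : Type*} [NormedAddCommGroup E] [NormedSpace ℝ E] [TopologicalSpace H]
  {I : ModelWithCorners ℝ E H} [I.Boundaryless] [NormedAddCommGroup F] [NormedSpace ℝ F]
  [TopologicalSpace M] [ChartedSpace H M] {f : M → F} {p : M}

theorem contDiffAt_comp_extChartAt_symm {k : WithTop ℕ∞} (hf : ContMDiffAt I 𝓘(ℝ, F) k f p) :
    ContDiffAt ℝ k (f ∘ (extChartAt I p).symm) (extChartAt I p p) := by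
  have h := (contMDiffAt_iff.1 hf).2
  rwa [I.range_eq_univ, contDiffWithinAt_univ] at h

theorem differentiableAt_comp_extChartAt_symm (hf : MDifferentiableAt I 𝓘(ℝ, F) f p) :
    DifferentiableAt ℝ (f ∘ (extChartAt I p).symm) (extChartAt I p p) := by
  have h := ((mdifferentiableAt_iff _ _).1 hf).2
  rwa [I.range_eq_univ, differentiableWithinAt_univ] at h

theorem fderiv_comp_extChartAt_symm (hf : MDifferentiableAt I 𝓘(ℝ, F) f p) :
    fderiv ℝ (f ∘ (extChartAt I p).symm) (extChartAt I p p) = mfderiv I 𝓘(ℝ, F) f p := by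
  rw [hf.mfderiv, I.range_eq_univ, fderivWithin_univ]
  rfl

end Chart

section ManifoldForms

variable {N m : ℕ} {M : Type*} [TopologicalSpace M] [ChartedSpace (EuclideanSpace ℝ (Fin m)) M]
  {ι : M → CSpace N} {p : M} {α α' : M → CSpace N →L[ℝ] ℂ}

theorem fderiv_comp_extChartAt_symm_mem_tangentSub [IsManifold (𝓡 m) 1 M]
    {u : EuclideanSpace ℝ (Fin m)} (hu : u ∈ (extChartAt (𝓡 m) p).target)
    (hι : MDifferentiableAt (𝓡 m) 𝓘(ℝ, CSpace N) ι ((extChartAt (𝓡 m) p).symm u))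
    (v : EuclideanSpace ℝ (Fin m)) :
    fderiv ℝ (ι ∘ (extChartAt (𝓡 m) p).symm) u v ∈
      tangentSub m ι ((extChartAt (𝓡 m) p).symm u) := by
  have hsymm : MDifferentiableAt 𝓘(ℝ, EuclideanSpace ℝ (Fin m)) (𝓡 m)
      (extChartAt (𝓡 m) p).symm u := by
    have h := mdifferentiableWithinAt_extChartAt_symm hu
    rwa [ModelWithCorners.range_eq_univ, mdifferentiableWithinAt_univ] at h
  rw [← mfderiv_eq_fderiv, mfderiv_comp u hι hsymm]
  exact ⟨_, rfl⟩

theorem differentiableAt_chartForm (hι : ContMDiffAt (𝓡 m) 𝓘(ℝ, CSpace N) 2 ι p)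
    (hα : MDifferentiableAt (𝓡 m) 𝓘(ℝ, CSpace N →L[ℝ] ℂ) α p) :
    DifferentiableAt ℝ (chartForm m ι α p) (extChartAt (𝓡 m) p p) :=
  (differentiableAt_comp_extChartAt_symm hα).clm_comp <|
    ((contDiffAt_comp_extChartAt_symm hι).fderiv_right (m := 1) le_rfl).differentiableAt
      one_ne_zero

theorem chartForm_extChartAt_self (hι : MDifferentiableAt (𝓡 m) 𝓘(ℝ, CSpace N) ι p) :
    chartForm m ι α p (extChartAt (𝓡 m) p p) = (α p).comp (embDeriv m ι p) := by
  rw [chartForm, extChartAt_to_inv, fderiv_comp_extChartAt_symm hι]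
  rfl

theorem extDerivM_embDeriv (hinj : Function.Injective (embDeriv m ι p))
    (v w : EuclideanSpace ℝ (Fin m)) :
    extDerivM m ι α p ![embDeriv m ι p v, embDeriv m ι p w] =
      extDeriv1 (chartForm m ι α p) (extChartAt (𝓡 m) p p) ![v, w] := by
  have h := LinearMap.leftInverse_apply_of_inj (LinearMap.ker_eq_bot.2 hinj)
  rw [extDerivM, ContinuousAlternatingMap.compContinuousLinearMap_apply]
  refine congrArg _ (funext fun i => ?_)
  fin_cases i
  exacts [h v, h w]

theorem extDerivM_congr [IsManifold (𝓡 m) 1 M]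
    (hι : ∀ᶠ q in 𝓝 p, MDifferentiableAt (𝓡 m) 𝓘(ℝ, CSpace N) ι q)
    (h : ∀ᶠ q in 𝓝 p, ∀ v ∈ tangentSub m ι q, α q v = α' q v) :
    extDerivM m ι α p = extDerivM m ι α' p := by
  have hsymm : Filter.Tendsto (extChartAt (𝓡 m) p).symm (𝓝 (extChartAt (𝓡 m) p p)) (𝓝 p) := by
    simpa only [extChartAt_to_inv] using (continuousAt_extChartAt_symm (I := 𝓡 m) p).tendsto
  rw [extDerivM, extDerivM, extDeriv1_congr]
  filter_upwards [extChartAt_target_mem_nhds (I := 𝓡 m) p, hsymm.eventually hι,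
    hsymm.eventually h] with u hu hιu hαu
  ext v
  exact hαu _ (fderiv_comp_extChartAt_symm_mem_tangentSub hu hιu v)

theorem extDerivM_add (hι : ContMDiffAt (𝓡 m) 𝓘(ℝ, CSpace N) 2 ι p)
    (hα : MDifferentiableAt (𝓡 m) 𝓘(ℝ, CSpace N →L[ℝ] ℂ) α p)
    (hα' : MDifferentiableAt (𝓡 m) 𝓘(ℝ, CSpace N →L[ℝ] ℂ) α' p) :
    extDerivM m ι (fun q => α q + α' q) p = extDerivM m ι α p + extDerivM m ι α' p := by
  have hadd : chartForm m ι (fun q => α q + α' q) p =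
      fun u => chartForm m ι α p u + chartForm m ι α' p u := rfl
  rw [extDerivM, hadd,
    extDeriv1_add (differentiableAt_chartForm hι hα) (differentiableAt_chartForm hι hα')]
  rfl

theorem extDerivM_smul_apply_of_eq_zero (hι : ContMDiffAt (𝓡 m) 𝓘(ℝ, CSpace N) 2 ι p)
    (hinj : Function.Injective (embDeriv m ι p)) {g : M → ℂ}
    (hg : MDifferentiableAt (𝓡 m) 𝓘(ℝ, ℂ) g p)
    (hα : MDifferentiableAt (𝓡 m) 𝓘(ℝ, CSpace N →L[ℝ] ℂ) α p) {x y : CSpace N}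
    (hx : x ∈ tangentSub m ι p) (hy : y ∈ tangentSub m ι p) (hαx : α p x = 0) (hαy : α p y = 0) :
    extDerivM m ι (fun q => g q • α q) p ![x, y] = g p * extDerivM m ι α p ![x, y] := by
  obtain ⟨v, rfl⟩ := hx
  obtain ⟨w, rfl⟩ := hy
  have hself := chartForm_extChartAt_self (α := α) (hι.mdifferentiableAt two_ne_zero)
  have hv : chartForm m ι α p (extChartAt (𝓡 m) p p) v = 0 := by rw [hself]; exact hαx
  have hw : chartForm m ι α p (extChartAt (𝓡 m) p p) w = 0 := by rw [hself]; exact hαy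
  have hsmul : chartForm m ι (fun q => g q • α q) p =
      fun u => (g ∘ (extChartAt (𝓡 m) p).symm) u • chartForm m ι α p u := rfl
  refine (extDerivM_embDeriv hinj v w).trans ?_
  rw [hsmul, extDeriv1_smul_apply (differentiableAt_comp_extChartAt_symm hg)
    (differentiableAt_chartForm hι hα), hv, hw, mul_zero, mul_zero, sub_zero, zero_add,
    Function.comp_apply, extChartAt_to_inv, ← extDerivM_embDeriv hinj v w]
  rfl

theorem extDerivM_comp_apply (hι : ContMDiffAt (𝓡 m) 𝓘(ℝ, CSpace N) 2 ι p)
    (hinj : Function.Injective (embDeriv m ι p)) {β : CSpace N → CSpace N →L[ℝ] ℂ}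
    (hβ : DifferentiableAt ℝ β (ι p)) {x y : CSpace N}
    (hx : x ∈ tangentSub m ι p) (hy : y ∈ tangentSub m ι p) :
    extDerivM m ι (β ∘ ι) p ![x, y] = extDeriv1 β (ι p) ![x, y] := by
  obtain ⟨v, rfl⟩ := hx
  obtain ⟨w, rfl⟩ := hy
  have hφp : (ι ∘ (extChartAt (𝓡 m) p).symm) (extChartAt (𝓡 m) p p) = ι p := by
    rw [Function.comp_apply, extChartAt_to_inv]
  have hpull : extDeriv1 (chartForm m ι (β ∘ ι) p) (extChartAt (𝓡 m) p p) =
      (extDeriv1 β (ι p)).compContinuousLinearMap (embDeriv m ι p) := by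
    refine (extDeriv1_comp_fderiv (by rwa [hφp]) (contDiffAt_comp_extChartAt_symm hι)).trans ?_
    rw [hφp, fderiv_comp_extChartAt_symm (hι.mdifferentiableAt two_ne_zero)]
    rfl
  refine (extDerivM_embDeriv hinj v w).trans ?_
  rw [hpull, ContinuousAlternatingMap.compContinuousLinearMap_apply]
  refine congrArg _ (funext fun i => ?_)
  fin_cases i <;> rfl

end ManifoldForms

section TangentialOperators

variable {N m : ℕ} {M : Type*} [TopologicalSpace M] [ChartedSpace (EuclideanSpace ℝ (Fin m)) M]
  {ι : M → CSpace N} {p : M}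

theorem differentiableAt_component1_fderiv {lam : CSpace N → ℂ} {x : CSpace N}
    (hlam : ContDiffAt ℝ 2 lam x) (S : Submodule ℂ (CTan N)) :
    DifferentiableAt ℝ (fun y => component1 S (fderiv ℝ lam y)) x :=
  (differentiable_component1 S _).comp x <|
    (hlam.fderiv_right (m := 1) le_rfl).differentiableAt one_ne_zero

theorem mdifferentiableAt_pair1_fderiv {lam : CSpace N → ℂ} {B : M → CTan N}
    (hι : MDifferentiableAt (𝓡 m) 𝓘(ℝ, CSpace N) ι p) (hlam : ContDiffAt ℝ 2 lam (ι p))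
    (hB : MDifferentiableAt (𝓡 m) 𝓘(ℝ, CTan N) B p) :
    MDifferentiableAt (𝓡 m) 𝓘(ℝ, ℂ) (fun q => pair1 (fderiv ℝ lam (ι q)) (B q)) p := by
  have hdlam : DifferentiableAt ℝ (fderiv ℝ lam) (ι p) :=
    (hlam.fderiv_right (m := 1) le_rfl).differentiableAt one_ne_zero
  exact (differentiable_pair1 _).mdifferentiableAt.comp p
    ((hdlam.mdifferentiableAt.comp p hι).prodMk_space hB)

variable [IsManifold (𝓡 m) 1 M] {α γ : M → CSpace N →L[ℝ] ℂ} {U : Set M} {Ln : M → CTan N}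

theorem extDerivM_apply_eq_add_mul (hι : ContMDiff (𝓡 m) 𝓘(ℝ, CSpace N) 2 ι)
    (hinj : Function.Injective (embDeriv m ι p)) {β : CSpace N → CSpace N →L[ℝ] ℂ} {g : M → ℂ}
    (hβ : DifferentiableAt ℝ β (ι p)) (hg : MDifferentiableAt (𝓡 m) 𝓘(ℝ, ℂ) g p)
    (hγ : MDifferentiableAt (𝓡 m) 𝓘(ℝ, CSpace N →L[ℝ] ℂ) γ p)
    (hα : ∀ᶠ q in 𝓝 p, ∀ v ∈ tangentSub m ι q, α q v = β (ι q) v + g q * γ q v)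
    {x y : CSpace N} (hx : x ∈ tangentSub m ι p) (hy : y ∈ tangentSub m ι p)
    (hγx : γ p x = 0) (hγy : γ p y = 0) :
    extDerivM m ι α p ![x, y] =
      extDeriv1 β (ι p) ![x, y] + g p * extDerivM m ι γ p ![x, y] := by
  have hdiff : MDifferentiable (𝓡 m) 𝓘(ℝ, CSpace N) ι := hι.mdifferentiable two_ne_zero
  have hβι : MDifferentiableAt (𝓡 m) 𝓘(ℝ, CSpace N →L[ℝ] ℂ) (β ∘ ι) p :=
    hβ.mdifferentiableAt.comp p (hdiff p)
  have hgγ : MDifferentiableAt (𝓡 m) 𝓘(ℝ, CSpace N →L[ℝ] ℂ) (fun q => g q • γ q) p :=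
    ((differentiable_fst.fun_smul differentiable_snd) (g p, γ p)).mdifferentiableAt.comp p
      (hg.prodMk_space hγ)
  have hcongr : extDerivM m ι α p = extDerivM m ι (fun q => (β ∘ ι) q + g q • γ q) p :=
    extDerivM_congr (Filter.Eventually.of_forall hdiff) hα
  rw [hcongr, extDerivM_add (hι p) hβι hgγ, ContinuousAlternatingMap.add_apply,
    extDerivM_comp_apply (hι p) hinj hβ hx hy,
    extDerivM_smul_apply_of_eq_zero (hι p) hinj hg hγ hx hy hγx hγy]

theorem IsCharacteristicForm.pair2_extDerivM (hγ : IsCharacteristicForm m ι U γ) (hU : IsOpen U)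
    (hp : p ∈ U) (hι : ContMDiff (𝓡 m) 𝓘(ℝ, CSpace N) 2 ι)
    (hinj : Function.Injective (embDeriv m ι p)) {β : CSpace N → CSpace N →L[ℝ] ℂ} {g : M → ℂ}
    (hβ : DifferentiableAt ℝ β (ι p)) (hg : MDifferentiableAt (𝓡 m) 𝓘(ℝ, ℂ) g p)
    (hα : ∀ q ∈ U, ∀ v ∈ tangentSub m ι q, α q v = β (ι q) v + g q * γ q v)
    {Z W : CTan N} (hZ : Z ∈ T10M m ι p ⊔ T01M m ι p) (hW : W ∈ T10M m ι p ⊔ T01M m ι p) :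
    pair2 (extDerivM m ι α p) Z W =
      pair2 (extDeriv1 β (ι p)) Z W + g p * pair2 (extDerivM m ι γ p) Z W := by
  have hγp := (hγ.smooth.contMDiffAt (hU.mem_nhds hp)).mdifferentiableAt (by simp)
  refine pair2_eq_add_mul (S := holTangent m ι p) (fun x hx y hy => ?_)
    (T10M_sup_T01M_le_span_holTangent hZ) (T10M_sup_T01M_le_span_holTangent hW)
  exact extDerivM_apply_eq_add_mul hι hinj hβ hg hγp
    (Filter.eventually_of_mem (hU.mem_nhds hp) hα) (holTangent_le_tangentSub hx)
    (holTangent_le_tangentSub hy) (hγ.apply_eq_zero hp hx) (hγ.apply_eq_zero hp hy)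

namespace IsTransversalField

theorem pair2_extDerivM_delb (h : IsTransversalField m ι U Ln) (hU : IsOpen U) (hp : p ∈ U)
    (hι : ContMDiff (𝓡 m) 𝓘(ℝ, CSpace N) 2 ι)
    (hm : ∀ q ∈ U, m = 2 * Module.finrank ℂ (T10M m ι q) + 1)
    (hγ : IsCharacteristicForm m ι U γ)
    (hγT : ∀ q ∈ U, pair1 (γ q) (Ln q - CTan.conj (Ln q)) = -1)
    {lam : CSpace N → ℂ} (hlam : ContDiffAt ℝ 2 lam (ι p))
    {Z W : CTan N} (hZ : Z ∈ T10M m ι p ⊔ T01M m ι p) (hW : W ∈ T10M m ι p ⊔ T01M m ι p) :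
    pair2 (extDerivM m ι (delb m ι lam) p) Z W =
      pair2 (extDeriv1 (del lam) (ι p)) Z W
        + pair1 (fderiv ℝ lam (ι p)) (Ln p) * pair2 (extDerivM m ι γ p) Z W := by
  have hLn := (h.smooth.contMDiffAt (hU.mem_nhds hp)).mdifferentiableAt (by simp)
  exact hγ.pair2_extDerivM hU hp hι (h.injective_embDeriv hp (hm p hp))
    (differentiableAt_component1_fderiv hlam _)
    (mdifferentiableAt_pair1_fderiv (hι.mdifferentiable two_ne_zero p) hlam hLn)
    (fun q hq _ hv => h.delb_eq hq (hm q hq) hγ (hγT q hq) lam hv) hZ hW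

theorem pair2_extDerivM_dbarb (h : IsTransversalField m ι U Ln) (hU : IsOpen U) (hp : p ∈ U)
    (hι : ContMDiff (𝓡 m) 𝓘(ℝ, CSpace N) 2 ι)
    (hm : ∀ q ∈ U, m = 2 * Module.finrank ℂ (T10M m ι q) + 1)
    (hγ : IsCharacteristicForm m ι U γ)
    (hγT : ∀ q ∈ U, pair1 (γ q) (Ln q - CTan.conj (Ln q)) = -1)
    {lam : CSpace N → ℂ} (hlam : ContDiffAt ℝ 2 lam (ι p))
    {Z W : CTan N} (hZ : Z ∈ T10M m ι p ⊔ T01M m ι p) (hW : W ∈ T10M m ι p ⊔ T01M m ι p) :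
    pair2 (extDerivM m ι (dbarb m ι lam) p) Z W =
      pair2 (extDeriv1 (dbar lam) (ι p)) Z W
        + -pair1 (fderiv ℝ lam (ι p)) (CTan.conj (Ln p)) * pair2 (extDerivM m ι γ p) Z W := by
  have hLn := (h.smooth.contMDiffAt (hU.mem_nhds hp)).mdifferentiableAt (by simp)
  have hconj := (CTan.differentiable_conj (Ln p)).mdifferentiableAt.comp p hLn
  exact hγ.pair2_extDerivM hU hp hι (h.injective_embDeriv hp (hm p hp))
    (differentiableAt_component1_fderiv hlam _)
    (mdifferentiableAt_pair1_fderiv (hι.mdifferentiable two_ne_zero p) hlam hconj).neg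
    (fun q hq _ hv => h.dbarb_eq hq (hm q hq) hγ (hγT q hq) lam hv) hZ hW

end IsTransversalField

end TangentialOperators

theorem mainTheorem4_general {N m : ℕ}
    {M : Type*} [TopologicalSpace M] [ChartedSpace (EuclideanSpace ℝ (Fin m)) M]
    [IsManifold (𝓡 m) 1 M] {ι : M → CSpace N} (hι : ContMDiff (𝓡 m) 𝓘(ℝ, CSpace N) 2 ι)
    {U : Set M} (hU : IsOpen U) (hm : ∀ q ∈ U, m = 2 * Module.finrank ℂ (T10M m ι q) + 1)
    {Ln : M → CTan N} (hLn : IsTransversalField m ι U Ln)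
    {γ : M → CSpace N →L[ℝ] ℂ} (hγ : IsCharacteristicForm m ι U γ)
    (hγT : ∀ p ∈ U, pair1 (γ p) (Ln p - CTan.conj (Ln p)) = -1)
    {p : M} (hp : p ∈ U) {lam : CSpace N → ℂ} (hlam : ContDiffAt ℝ 2 lam (ι p))
    {L : CTan N} (hL : L ∈ T10M m ι p) :
    1 / 2 * (del01 (dbar lam) (ι p) L (CTan.conj L) - dbar10 (del lam) (ι p) L (CTan.conj L))
      - 1 / 2 * (delb01 m ι (dbarb m ι lam) p L (CTan.conj L)
          - dbarb10 m ι (delb m ι lam) p L (CTan.conj L))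
      = 1 / 2 * pair1 (fderiv ℝ lam (ι p)) (Ln p + CTan.conj (Ln p)) * leviForm m ι γ p L L := by
  have hconj := conj_mem_T01M hL
  have hL' := Submodule.mem_sup_left (T := T01M m ι p) hL
  have hconj' := Submodule.mem_sup_right (S := T10M m ι p) hconj
  rw [del01, dbar10, delb01, dbarb10,
    component11_apply_of_mem CTan.isOrtho_T10_T01 _ (T10M_le_T10 hL) (T01M_le_T01 hconj),
    component11_apply_of_mem CTan.isOrtho_T10_T01 _ (T10M_le_T10 hL) (T01M_le_T01 hconj),
    component11_apply_of_mem isOrtho_T10M_T01M _ hL hconj,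
    component11_apply_of_mem isOrtho_T10M_T01M _ hL hconj,
    hLn.pair2_extDerivM_delb hU hp hι hm hγ hγT hlam hL' hconj',
    hLn.pair2_extDerivM_dbarb hU hp hι hm hγ hγT hlam hL' hconj', leviForm, map_add]
  ring

theorem mainTheorem4 {n N : ℕ} (hn : 1 ≤ n) (hnN : n ≤ N)
    {M : Type*} [TopologicalSpace M] [CompactSpace M]
    [ChartedSpace (EuclideanSpace ℝ (Fin (2 * n - 1))) M] [IsManifold (𝓡 (2 * n - 1)) ∞ M]
    (ι : M → CSpace N)
    (hι : Manifold.IsSmoothEmbedding (𝓡 (2 * n - 1)) 𝓘(ℝ, CSpace N) ∞ ι)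
    (hCR : IsCROfRank (2 * n - 1) ι n) (hpsc : IsWeaklyPseudoconvex (2 * n - 1) ι)
    (U : Set M) (hU : IsOpen U)
    (Ln : M → CTan N) (hLn : IsTransversalField (2 * n - 1) ι U Ln)
    (γ : M → CSpace N →L[ℝ] ℂ) (hγ : IsCharacteristicForm (2 * n - 1) ι U γ)
    (hγT : ∀ p ∈ U, pair1 (γ p) (Ln p - CTan.conj (Ln p)) = -1)
    (W : Set (CSpace N)) (hW : IsOpen W) (hMW : Set.range ι ⊆ W)
    (lam : CSpace N → ℂ) (hlam : ContDiffOn ℝ ∞ lam W)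
    (p : M) (hp : p ∈ U) (L : CTan N) (hL : L ∈ T10M (2 * n - 1) ι p) :
    1 / 2 * (del01 (dbar lam) (ι p) L (CTan.conj L) - dbar10 (del lam) (ι p) L (CTan.conj L))
      - 1 / 2 * (delb01 (2 * n - 1) ι (dbarb (2 * n - 1) ι lam) p L (CTan.conj L)
          - dbarb10 (2 * n - 1) ι (delb (2 * n - 1) ι lam) p L (CTan.conj L))
      = 1 / 2 * pair1 (fderiv ℝ lam (ι p)) (Ln p + CTan.conj (Ln p))
          * leviForm (2 * n - 1) ι γ p L L := by
  exact mainTheorem4_general (hι.contMDiff.of_le ENat.LEInfty.out) hU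
    (fun q _ => by rw [hCR q]; omega) hLn hγ hγT hp
    ((hlam.contDiffAt (hW.mem_nhds (hMW ⟨p, rfl⟩))).of_le ENat.LEInfty.out) hL
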